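/- Conventions. The Hausdorff dimension $\dim_H$ takes values in $[0,\infty]$ on nonempty metric spaces, and $\dim_H\varnothing=-1$. The topological Hausdorff dimension of a nonempty metric space $Z$ is $$\dim_{tH}Z=\inf\{c: Z\text{ has a basis }\mathcal U\text{ of its topology such that }\dim_H\partial U\le c-1\text{ for all }U\in\mathcal U\}\in[0,\infty],$$ where $\inf\varnothing=\infty$, and $\dim_{tH}\varnothing=-1$. A metric space $X$ is Ahlfors $d$-regular if there are a Borel regular measure $\mu$ on $X$ and a constant $K\ge 1$ such that $\frac1K r^d\le\mu(\overline B(x,r))\le K r^d$ for all $x\in X$ and all $0<r<2\operatorname{diam}X$. The product $X\times Y$ carries the metric $\max(d_X(x_1,x_2),d_Y(y_1,y_2))$. Theorem. Let $d$ be a real number, let $X$ be a nonempty metric space that is locally compact, Ahlfors $d$-regular and totally disconnected, and let $Y$ be a separable metric space with $\dim_{tH}Y\ge 1$. Then $$\dim_{tH}(X\times Y)=\dim_H X+\dim_{tH}Y,$$ both sides being possibly $\infty$. -/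

import Mathlib

open Set TopologicalSpace MeasureTheory

/-- Hausdorff dimension of a subset of a metric space, with values in the extended reals and with
the convention that the empty set has dimension `-1`. -/
noncomputable def hausdorffDim {X : Type*} [MetricSpace X] (A : Set X) : EReal :=
  open Classical in if A = ∅ then -1 else (dimH A : EReal)

/-- Topological Hausdorff dimension: the infimum of all `c` such that `X` has a basis of its
topology all of whose members have boundary of Hausdorff dimension at most `c - 1`
(the infimum is `⊤` if there is no finite such `c`); the empty space has dimension `-1`. -/
noncomputable def topHausdorffDim (X : Type*) [MetricSpace X] : EReal :=
  open Classical in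
  if IsEmpty X then -1 else
    sInf {c : EReal | ∃ B : Set (Set X), IsTopologicalBasis B ∧
      ∀ U ∈ B, hausdorffDim (frontier U) ≤ c - 1}

/-- Ahlfors `d`-regularity: there are a Borel measure `μ` (whose associated outer measure in Mathlib
is automatically Borel regular) and a constant `K ≥ 1` with `r ^ d / K ≤ μ (closedBall x r) ≤ K r ^ d`
for all points `x` and all radii `0 < r < 2 diam X` (the diameter may be infinite). -/
def IsAhlforsRegular (X : Type*) [MetricSpace X] [MeasurableSpace X] [BorelSpace X]
    (d : ℝ) : Prop :=
  ∃ (μ : Measure X) (K : ℝ), 1 ≤ K ∧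
    ∀ (x : X) (r : ℝ), 0 < r → ENNReal.ofReal r < 2 * Metric.ediam (univ : Set X) →
      ENNReal.ofReal (r ^ d / K) ≤ μ (Metric.closedBall x r) ∧
        μ (Metric.closedBall x r) ≤ ENNReal.ofReal (K * r ^ d)

/-! Upper bound: a locally compact, totally disconnected metric space has a basis of clopen sets, so
`X × Y` has a basis of products of a clopen `V` with a member `U` of a basis of `Y`. The boundary of
such a product is `V ×ˢ frontier U`. Regularity controls the covering numbers of `X`, not just its
Hausdorff dimension, so crossing with `X` adds at most `d` to the dimension
(`HasPowerGrowth.dimH_prod_le`).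

Lower bound: the slices over a point `x` of the members of a basis of `X × Y` form a basis of `Y`,
with boundaries inside the slices of the original boundaries. An Eilenberg-type inequality
(`HasPowerGrowth.ae_hausdorffMeasure_slice_eq_zero`) shows that almost every slice of a set loses
`d` dimensions. By separability the basis can be taken countable, so a single `x` serves all its
members. If the boundaries had dimension below `d`, the slices would be empty and `Y` would have
dimension at most `0`; this is where `1 ≤ topHausdorffDim Y` is essential. -/

open Filter Metric
open scoped NNReal ENNReal Topology MeasureTheory

/-! ### Power growth from Ahlfors regularity -/

/-- Uniform two-sided power bounds for the measure of balls, the upper bound at all radii and the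
lower bound at small radii. -/
structure HasPowerGrowth {X : Type*} [MetricSpace X] [MeasurableSpace X] (μ : Measure X)
    (d C ρ : ℝ≥0) : Prop where
  pos : 0 < ρ
  upper : ∀ (x : X) (r : ℝ≥0), μ (closedBall x r) ≤ C * (r : ℝ≥0∞) ^ (d : ℝ)
  lower : ∀ (x : X) (r : ℝ≥0), 0 < r → r < ρ → (r : ℝ≥0∞) ^ (d : ℝ) ≤ C * μ (closedBall x r)

lemma hasPowerGrowth_dirac {X : Type*} [MetricSpace X] [MeasurableSpace X] [BorelSpace X]
    [Subsingleton X] (x : X) : HasPowerGrowth (Measure.dirac x) 0 1 1 := by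
  have h : ∀ (y : X) (r : ℝ≥0), Measure.dirac x (closedBall y r) = 1 := fun y r ↦
    Measure.dirac_apply_of_mem (by rw [Subsingleton.elim x y]; exact mem_closedBall_self r.coe_nonneg)
  refine ⟨one_pos, fun y r ↦ ?_, fun y r _ _ ↦ ?_⟩ <;> simp [h]

/-- For `d < 0` the lower bound blows up as `r → 0`, while the measure of small balls is at most
that of the ball of radius `r₀`. -/
lemma nonneg_of_ball_bounds {X : Type*} [MetricSpace X] [MeasurableSpace X] {μ : Measure X}
    {d K r₀ : ℝ} (hK : 1 ≤ K) (hr₀ : 0 < r₀) (x : X)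
    (h : ∀ r, 0 < r → r ≤ r₀ → ENNReal.ofReal (r ^ d / K) ≤ μ (closedBall x r) ∧
      μ (closedBall x r) ≤ ENNReal.ofReal (K * r ^ d)) : 0 ≤ d := by
  by_contra! hd
  have h1 : ∀ᶠ r in 𝓝[>] (0 : ℝ), K * (K * r₀ ^ d) < r ^ d :=
    (tendsto_rpow_neg_nhdsGT_zero hd).eventually_gt_atTop _
  have h2 : ∀ᶠ r in 𝓝[>] (0 : ℝ), r ∈ Ioc 0 r₀ := Ioc_mem_nhdsGT hr₀
  obtain ⟨r, hr, hr0, hr1⟩ := (h1.and h2).exists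
  have h3 := ((h r hr0 hr1).1.trans (measure_mono (closedBall_subset_closedBall hr1))).trans
    (h r₀ hr₀ le_rfl).2
  rw [ENNReal.ofReal_le_ofReal_iff (by positivity), div_le_iff₀ (by positivity)] at h3
  linarith

lemma IsAhlforsRegular.exists_hasPowerGrowth {X : Type*} [MetricSpace X] [MeasurableSpace X]
    [BorelSpace X] [Nonempty X] {d : ℝ} (hX : IsAhlforsRegular X d) :
    ∃ (μ : Measure X) (d' C ρ : ℝ≥0), HasPowerGrowth μ d' C ρ := by
  -- On a one-point space no radius is admissible, so regularity says nothing about `d`. Hence the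
  -- exponent `d'` need not be `d`; only its equality with `dimH univ` is used later.
  rcases subsingleton_or_nontrivial X with _ | _
  · exact ⟨_, _, _, _, hasPowerGrowth_dirac (Classical.arbitrary X)⟩
  obtain ⟨μ, K, hK, h⟩ := hX
  have hdiam : 0 < ediam (univ : Set X) := ediam_pos_iff.2 nontrivial_univ
  obtain ⟨ρ, hρ0, hρ⟩ : ∃ ρ : ℝ≥0, 0 < ρ ∧ (ρ : ℝ≥0∞) < 2 * ediam (univ : Set X) := by
    obtain ⟨ρ, h1, h2⟩ := ENNReal.lt_iff_exists_nnreal_btwn.1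
      (show 0 < 2 * ediam (univ : Set X) from ENNReal.mul_pos (by simp) hdiam.ne')
    exact ⟨ρ, by exact_mod_cast h1, h2⟩
  have hsmall : ∀ r : ℝ, 0 < r → r ≤ ρ → ENNReal.ofReal r < 2 * ediam (univ : Set X) :=
    fun r _ hr ↦ (ENNReal.ofReal_le_of_le_toReal (by simpa using hr)).trans_lt hρ
  have hd : 0 ≤ d := nonneg_of_ball_bounds hK (NNReal.coe_pos.2 hρ0) (Classical.arbitrary X)
    fun r hr0 hr ↦ h _ r hr0 (hsmall r hr0 hr)
  lift d to ℝ≥0 using hd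
  lift K to ℝ≥0 using by linarith
  have hK0 : (0 : ℝ) < K := by linarith
  have hpow : ∀ r : ℝ≥0, ENNReal.ofReal ((r : ℝ) ^ (d : ℝ)) = (r : ℝ≥0∞) ^ (d : ℝ) := fun r ↦ by
    rw [← ENNReal.ofReal_rpow_of_nonneg r.coe_nonneg d.coe_nonneg, ENNReal.ofReal_coe_nnreal]
  have hup : ∀ (x : X) (r : ℝ≥0), 0 < r → (r : ℝ≥0∞) < 2 * ediam (univ : Set X) →
      μ (closedBall x r) ≤ K * (r : ℝ≥0∞) ^ (d : ℝ) := fun x r hr hr' ↦ by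
    have := (h x r (by exact_mod_cast hr) (by simpa using hr')).2
    rwa [ENNReal.ofReal_mul hK0.le, hpow, ENNReal.ofReal_coe_nnreal] at this
  have hup' : ∀ (x : X) (r : ℝ≥0), 0 < r → μ (closedBall x r) ≤ K * (r : ℝ≥0∞) ^ (d : ℝ) := by
    intro x r hr
    rcases lt_or_ge (r : ℝ≥0∞) (2 * ediam (univ : Set X)) with hlt | hge
    · exact hup x r hr hlt
    -- A ball of larger radius lies in the ball of radius `D = diam X`, which is admissible because
    -- `D < 2 * D`.
    have hfin : ediam (univ : Set X) ≠ ⊤ := by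
      intro htop
      simp [htop] at hge
    lift ediam (univ : Set X) to ℝ≥0 using hfin with D hD
    clear hsmall hρ
    have hD0 : 0 < D := by exact_mod_cast hdiam
    have huniv : closedBall x r ⊆ closedBall x D := fun y _ ↦ by
      rw [mem_closedBall, dist_nndist, NNReal.coe_le_coe, ← ENNReal.coe_le_coe, hD, ← edist_nndist]
      exact edist_le_ediam_of_mem (mem_univ _) (mem_univ _)
    have hDr : D ≤ r := by
      have : 2 * D ≤ r := by exact_mod_cast hge
      exact (le_mul_of_one_le_left D.2 one_le_two).trans this
    calc μ (closedBall x r) ≤ μ (closedBall x D) := measure_mono huniv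
      _ ≤ K * (D : ℝ≥0∞) ^ (d : ℝ) := hup x D hD0 (by
          exact_mod_cast (lt_mul_of_one_lt_left hD0 one_lt_two))
      _ ≤ K * (r : ℝ≥0∞) ^ (d : ℝ) := by gcongr
  refine ⟨μ, d, K, ρ, hρ0, fun x r ↦ ?_, fun x r hr0 hr ↦ ?_⟩
  -- Letting radii decrease to `r` includes `r = 0`, which is needed when a covering set is a single
  -- point.
  · have hcont : Tendsto (fun r : ℝ≥0 ↦ (K : ℝ≥0∞) * (r : ℝ≥0∞) ^ (d : ℝ)) (𝓝[>] r)
        (𝓝 (K * (r : ℝ≥0∞) ^ (d : ℝ))) := by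
      refine ENNReal.Tendsto.const_mul ?_ (Or.inr ENNReal.coe_ne_top)
      exact ((ENNReal.continuous_rpow_const.comp ENNReal.continuous_coe).tendsto r).mono_left
        nhdsWithin_le_nhds
    refine ge_of_tendsto hcont ?_
    filter_upwards [self_mem_nhdsWithin] with s (hs : r < s)
    exact (measure_mono (closedBall_subset_closedBall (NNReal.coe_le_coe.2 hs.le))).trans
      (hup' x s (zero_le.trans_lt hs))
  · have := (h x r (by exact_mod_cast hr0) (hsmall r (by exact_mod_cast hr0) hr.le)).1
    rw [ENNReal.ofReal_div_of_pos hK0, hpow, ENNReal.ofReal_coe_nnreal] at this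
    rw [mul_comm]
    exact (ENNReal.div_le_iff (by exact_mod_cast hK0.ne') ENNReal.coe_ne_top).1 this

/-! ### Covering numbers and separability -/

/-- A bounded set in a space with power growth is covered by about `r ^ (-d)` balls of radius
`r`. -/
lemma HasPowerGrowth.exists_finset_cover {X : Type*} [MetricSpace X] [MeasurableSpace X]
    [BorelSpace X] {μ : Measure X} {d C ρ : ℝ≥0} (h : HasPowerGrowth μ d C ρ) (x : X) (R : ℝ≥0) :
    ∃ M : ℝ≥0, ∀ r : ℝ≥0, 0 < r → r < ρ → ∃ t : Finset X,
      closedBall x R ⊆ ⋃ y ∈ t, closedBall y r ∧ (t.card : ℝ≥0∞) * (r : ℝ≥0∞) ^ (d : ℝ) ≤ M := by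
  refine ⟨2 ^ (d : ℝ) * (C * (C * (R + ρ) ^ (d : ℝ))), fun r hr0 hr ↦ ?_⟩
  have hr2 : 0 < r / 2 := half_pos hr0
  -- Volume count: the balls of radius `r / 2` about an `r`-separated set are disjoint and lie in
  -- one ball of radius `R + ρ`.
  have key : ∀ t : Finset X, (t : Set X) ⊆ closedBall x R → IsSeparated (r : ℝ≥0∞) (t : Set X) →
      (t.card : ℝ≥0∞) * (r : ℝ≥0∞) ^ (d : ℝ)
        ≤ (2 ^ (d : ℝ) * (C * (C * (R + ρ) ^ (d : ℝ))) : ℝ≥0) := by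
    intro t ht hsep
    have hdisj : (t : Set X).PairwiseDisjoint fun y ↦ closedBall y (r / 2 : ℝ≥0) := by
      intro y hy z hz hyz
      refine closedBall_disjoint_closedBall ?_
      have : (r : ℝ≥0∞) < edist y z := hsep hy hz hyz
      rw [edist_nndist, ENNReal.coe_lt_coe, ← NNReal.coe_lt_coe, coe_nndist] at this
      push_cast
      linarith
    have hsub : (⋃ y ∈ t, closedBall y (r / 2 : ℝ≥0)) ⊆ closedBall x (R + ρ : ℝ≥0) := by
      refine iUnion₂_subset fun y hy ↦ closedBall_subset_closedBall' ?_
      have h1 := mem_closedBall.1 (ht hy)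
      have h2 : (r : ℝ) < ρ := hr
      have h3 : (0 : ℝ) < r := hr0
      push_cast
      linarith
    have h2r : (r : ℝ≥0∞) ^ (d : ℝ) = 2 ^ (d : ℝ) * ((r / 2 : ℝ≥0) : ℝ≥0∞) ^ (d : ℝ) := by
      rw [← ENNReal.mul_rpow_of_nonneg _ _ d.coe_nonneg]
      congr 1
      have : r = 2 * (r / 2) := by field_simp
      exact_mod_cast this
    calc (t.card : ℝ≥0∞) * (r : ℝ≥0∞) ^ (d : ℝ)
        = 2 ^ (d : ℝ) * ∑ _y ∈ t, ((r / 2 : ℝ≥0) : ℝ≥0∞) ^ (d : ℝ) := by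
          rw [Finset.sum_const, nsmul_eq_mul, h2r]; ring
      _ ≤ 2 ^ (d : ℝ) * ∑ y ∈ t, C * μ (closedBall y (r / 2 : ℝ≥0)) := by
          gcongr with y
          exact h.lower y _ hr2 ((NNReal.half_lt_self hr0.ne').trans hr)
      _ = 2 ^ (d : ℝ) * (C * μ (⋃ y ∈ t, closedBall y (r / 2 : ℝ≥0))) := by
          rw [← Finset.mul_sum, measure_biUnion_finset hdisj fun y _ ↦ measurableSet_closedBall]
      _ ≤ 2 ^ (d : ℝ) * (C * (C * ((R + ρ : ℝ≥0) : ℝ≥0∞) ^ (d : ℝ))) := by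
          gcongr
          exact (measure_mono hsub).trans (h.upper _ _)
      _ = _ := by
          simp only [ENNReal.coe_mul, ENNReal.coe_rpow_of_nonneg _ d.coe_nonneg, ENNReal.coe_add,
            ENNReal.coe_ofNat]
  have hne : packingNumber r (closedBall x (R : ℝ)) ≠ ⊤ := by
    have hbound : ∃ N : ℕ, (2 ^ (d : ℝ) * (C * (C * (R + ρ) ^ (d : ℝ))) : ℝ≥0) < N * r ^ (d : ℝ) := by
      obtain ⟨N, hN⟩ := exists_nat_gt
        ((2 ^ (d : ℝ) * (C * (C * (R + ρ) ^ (d : ℝ))) : ℝ≥0) / r ^ (d : ℝ))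
      exact ⟨N, (div_lt_iff₀ (NNReal.rpow_pos hr0)).1 hN⟩
    obtain ⟨N, hN⟩ := hbound
    -- `key` handles only finite sets, so a larger separated set is cut down to exactly `N` points.
    refine ne_top_of_le_ne_top (ENat.natCast_ne_top N) (iSup₂_le fun S hS ↦ iSup_le fun hsep ↦ ?_)
    by_contra! hlt
    obtain ⟨T, hTS, hT⟩ := exists_subset_encard_eq hlt.le
    obtain ⟨t, rfl⟩ := (finite_of_encard_eq_coe hT).exists_finset_coe
    rw [encard_coe_eq_coe_finsetCard] at hT
    have hcard : t.card = N := by exact_mod_cast hT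
    have := key t (hTS.trans hS) (hsep.subset hTS)
    rw [hcard, ← ENNReal.coe_rpow_of_nonneg _ d.coe_nonneg] at this
    exact absurd hN (not_lt.2 (by exact_mod_cast this))
  have hfin : (maximalSeparatedSet r (closedBall x (R : ℝ))).Finite := by
    rw [← encard_ne_top_iff, encard_maximalSeparatedSet hne]
    exact hne
  refine ⟨hfin.toFinset, fun y hy ↦ ?_, key _ ?_ ?_⟩
  · obtain ⟨z, hz, hyz⟩ := isCover_maximalSeparatedSet hne hy
    refine mem_iUnion₂.2 ⟨z, hfin.mem_toFinset.2 hz, ?_⟩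
    have hyz : edist y z ≤ r := hyz
    rwa [edist_nndist, ENNReal.coe_le_coe] at hyz
  · rw [hfin.coe_toFinset]; exact maximalSeparatedSet_subset
  · rw [hfin.coe_toFinset]; exact isSeparated_maximalSeparatedSet

lemma HasPowerGrowth.secondCountableTopology {X : Type*} [MetricSpace X] [MeasurableSpace X]
    [BorelSpace X] {μ : Measure X} {d C ρ : ℝ≥0} (h : HasPowerGrowth μ d C ρ) :
    SecondCountableTopology X := by
  rcases isEmpty_or_nonempty X with _ | ⟨⟨x⟩⟩
  · infer_instance
  have htb : ∀ n : ℕ, TotallyBounded (closedBall x (n : ℝ)) := by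
    intro n
    obtain ⟨M, hM⟩ := h.exists_finset_cover x n
    refine totallyBounded_iff.2 fun ε hε ↦ ?_
    obtain ⟨r, hr0, hr⟩ : ∃ r : ℝ≥0, 0 < r ∧ r < min ρ ε.toNNReal :=
      exists_between (lt_min h.pos (Real.toNNReal_pos.2 hε))
    obtain ⟨t, ht, -⟩ := hM r hr0 (hr.trans_le (min_le_left _ _))
    refine ⟨t, t.finite_toSet, ht.trans (iUnion₂_mono fun y _ ↦ closedBall_subset_ball ?_)⟩
    exact Real.lt_toNNReal_iff_coe_lt.1 (hr.trans_le (min_le_right _ _))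
  have hsep : IsSeparable (univ : Set X) := by
    rw [← iUnion_closedBall_nat x]
    exact IsSeparable.iUnion fun n ↦ (htb n).isSeparable
  have := isSeparable_univ_iff.1 hsep
  exact UniformSpace.secondCountable_of_separable X

lemma HasPowerGrowth.measure_ne_zero {X : Type*} [MetricSpace X] [MeasurableSpace X]
    [Nonempty X] {μ : Measure X} {d C ρ : ℝ≥0} (h : HasPowerGrowth μ d C ρ) : μ ≠ 0 := by
  rintro rfl
  have := h.lower (Classical.arbitrary X) (ρ / 2) (half_pos h.pos)
    (NNReal.half_lt_self h.pos.ne')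
  have hpos : (0 : ℝ≥0∞) < ((ρ / 2 : ℝ≥0) : ℝ≥0∞) ^ (d : ℝ) :=
    ENNReal.rpow_pos (ENNReal.coe_pos.2 (half_pos h.pos)) ENNReal.coe_ne_top
  simp only [Measure.coe_zero, Pi.zero_apply, mul_zero] at this
  exact hpos.not_ge this

/-! ### Hausdorff dimension of products -/

lemma exists_cover_tsum_lt_of_dimH_lt {X : Type*} [MetricSpace X] {s : ℝ≥0} {A : Set X}
    (hA : dimH A < s) {δ ε : ℝ≥0∞} (hδ : 0 < δ) (hε : 0 < ε) :
    ∃ t : ℕ → Set X, A ⊆ ⋃ n, t n ∧ (∀ n, ediam (t n) ≤ δ) ∧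
      ∑' n, ⨆ _ : (t n).Nonempty, ediam (t n) ^ (s : ℝ) < ε := by
  borelize X
  have hA := hausdorffMeasure_of_dimH_lt hA
  rw [Measure.hausdorffMeasure_apply] at hA
  have h := (ENNReal.iSup_eq_zero.1 (ENNReal.iSup_eq_zero.1 hA δ) hδ).trans_lt hε
  simp only [iInf_lt_iff] at h
  obtain ⟨t, h1, h2, h3⟩ := h
  exact ⟨t, h1, h2, h3⟩

/-- A set of dimension less than `s` has arbitrarily fine covers of `s`-dimensional size at most
`1` by sets to which positive radii are attached. -/
lemma exists_cover_of_dimH_lt {Y : Type*} [MetricSpace Y] {s : ℝ≥0} {B : Set Y} (hB : dimH B < s)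
    {δ : ℝ≥0} (hδ : 0 < δ) :
    ∃ (t : ℕ → Set Y) (r : ℕ → ℝ≥0), B ⊆ ⋃ n, t n ∧ (∀ n, 0 < r n ∧ r n ≤ δ ∧ ediam (t n) ≤ r n) ∧
      ∑' n, (r n : ℝ≥0∞) ^ (s : ℝ) ≤ 1 := by
  have hs : 0 < s := by exact_mod_cast (zero_le.trans_lt hB)
  have hs' : (0 : ℝ) < s := hs
  obtain ⟨t, htB, htδ, htsum⟩ := exists_cover_tsum_lt_of_dimH_lt hB
    (ENNReal.coe_pos.2 hδ)
    (ENNReal.inv_pos.2 (by simp : (2 : ℝ≥0∞) ≠ ⊤))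
  obtain ⟨w, hw0, hw⟩ := ENNReal.exists_pos_sum_of_countable
    (ENNReal.inv_ne_zero.2 (by simp : (2 : ℝ≥0∞) ≠ ⊤)) ℕ
  have htop : ∀ n, ediam (t n) ≠ ⊤ := fun n ↦ ne_top_of_le_ne_top ENNReal.coe_ne_top (htδ n)
  -- Sets of diameter zero also get a positive radius; the summable weights `w` pay for this with
  -- half of the budget `1`.
  refine ⟨t, fun n ↦ max (ediam (t n)).toNNReal (min δ (w n ^ (s : ℝ)⁻¹)), htB, fun n ↦ ⟨?_, ?_, ?_⟩,
    ?_⟩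
  · exact lt_max_of_lt_right (lt_min hδ (NNReal.rpow_pos (hw0 n)))
  · exact max_le (ENNReal.toNNReal_mono ENNReal.coe_ne_top (htδ n)) (min_le_left _ _)
  · rw [ENNReal.coe_max, ENNReal.coe_toNNReal (htop n)]
    exact le_max_left _ _
  · calc ∑' n, ((max (ediam (t n)).toNNReal (min δ (w n ^ (s : ℝ)⁻¹)) : ℝ≥0) : ℝ≥0∞) ^ (s : ℝ)
        ≤ ∑' n, ((⨆ _ : (t n).Nonempty, ediam (t n) ^ (s : ℝ)) + (w n : ℝ≥0∞)) := by
          refine ENNReal.tsum_le_tsum fun n ↦ ?_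
          rw [ENNReal.coe_max, ENNReal.coe_toNNReal (htop n),
            (ENNReal.monotone_rpow_of_nonneg s.coe_nonneg).map_max]
          refine max_le (le_add_right ?_) (le_add_left ?_)
          · rcases (t n).eq_empty_or_nonempty with he | hne
            · simp [he, hs]
            · exact le_iSup (fun _ : (t n).Nonempty ↦ ediam (t n) ^ (s : ℝ)) hne
          · rw [← ENNReal.coe_rpow_of_nonneg _ s.coe_nonneg, ENNReal.coe_le_coe]
            calc (min δ (w n ^ (s : ℝ)⁻¹)) ^ (s : ℝ) ≤ (w n ^ (s : ℝ)⁻¹) ^ (s : ℝ) := by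
                  gcongr; exact min_le_right _ _
              _ = w n := NNReal.rpow_inv_rpow hs'.ne' _
      _ = _ + _ := ENNReal.tsum_add
      _ ≤ 2⁻¹ + 2⁻¹ := add_le_add htsum.le hw.le
      _ = 1 := ENNReal.inv_two_add_inv_two

lemma ediam_closedBall_coe_le {X : Type*} [MetricSpace X] (x : X) (r : ℝ≥0) :
    ediam (closedBall x (r : ℝ)) ≤ 2 * r := by
  rw [← closedEBall_coe]
  exact ediam_closedEBall_le

lemma ediam_prod_le {X Y : Type*} [MetricSpace X] [MetricSpace Y] (s : Set X) (t : Set Y) :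
    ediam (s ×ˢ t) ≤ max (ediam s) (ediam t) :=
  ediam_le fun p hp q hq ↦ by
    rw [Prod.edist_eq]
    exact max_le_max (edist_le_ediam_of_mem hp.1 hq.1) (edist_le_ediam_of_mem hp.2 hq.2)

lemma ediam_preimage_prodMk_le {X Y : Type*} [MetricSpace X] [MetricSpace Y] (x : X)
    (A : Set (X × Y)) : ediam (Prod.mk x ⁻¹' A) ≤ ediam A :=
  ediam_le fun _ hy _ hz ↦ (le_max_right _ _).trans (edist_le_ediam_of_mem (s := A) hy hz)

/-- Above a piece of `B` of size `r`, about `r ^ (-d)` balls of radius `r` cover the ball in `X`.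
Their total contribution in dimension `d + s` is of order `r ^ s`, which is summable. -/
lemma HasPowerGrowth.dimH_closedBall_prod_le {X Y : Type*} [MetricSpace X] [MeasurableSpace X]
    [BorelSpace X] [MetricSpace Y] {μ : Measure X} {d C ρ : ℝ≥0} (h : HasPowerGrowth μ d C ρ)
    (x : X) (R : ℝ≥0) {B : Set Y} {s : ℝ≥0} (hB : dimH B < s) :
    dimH (closedBall x (R : ℝ) ×ˢ B) ≤ d + s := by
  obtain ⟨M, hM⟩ := h.exists_finset_cover x R
  obtain ⟨δ, -, hδ, hδlim⟩ := exists_seq_strictAnti_tendsto' h.pos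
  choose t r htB hr hsum using fun k ↦ exists_cover_of_dimH_lt hB (hδ k).1
  choose c hc hcard using fun k n ↦ hM (r k n) (hr k n).1 ((hr k n).2.1.trans_lt (hδ k).2)
  borelize (X × Y)
  have hbound : μH[((d + s : ℝ≥0) : ℝ)] (closedBall x (R : ℝ) ×ˢ B)
      ≤ 2 ^ ((d + s : ℝ≥0) : ℝ) * M := by
    refine (Measure.hausdorffMeasure_le_liminf_tsum (ι := fun k ↦ Σ n, c k n) (l := atTop)
      ((d + s : ℝ≥0) : ℝ) _ (fun k ↦ 2 * (δ k : ℝ≥0∞)) ?_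
      (fun k i ↦ closedBall (i.2 : X) (r k i.1) ×ˢ t k i.1) ?_ ?_).trans ?_
    · have : Tendsto (fun k ↦ ((2 * δ k : ℝ≥0) : ℝ≥0∞)) atTop (𝓝 ((2 * 0 : ℝ≥0) : ℝ≥0∞)) :=
        ENNReal.tendsto_coe.2 (hδlim.const_mul 2)
      simpa using this
    · refine Eventually.of_forall fun k i ↦ (ediam_prod_le _ _).trans (max_le ?_ ?_)
      · refine (ediam_closedBall_coe_le _ _).trans ?_
        gcongr
        exact (hr k i.1).2.1
      · refine (hr k i.1).2.2.trans ((ENNReal.coe_le_coe.2 (hr k i.1).2.1).trans ?_)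
        exact le_mul_of_one_le_left zero_le one_le_two
    · refine Eventually.of_forall fun k p hp ↦ ?_
      obtain ⟨n, hn⟩ := mem_iUnion.1 (htB k hp.2)
      obtain ⟨y, hy, hpy⟩ := mem_iUnion₂.1 (hc k n hp.1)
      exact mem_iUnion.2 ⟨⟨n, y, hy⟩, hpy, hn⟩
    · refine liminf_le_of_frequently_le' (Frequently.of_forall fun k ↦ ?_)
      rw [ENNReal.tsum_sigma fun n (y : c k n) ↦
        ediam (closedBall (y : X) (r k n) ×ˢ t k n) ^ ((d + s : ℝ≥0) : ℝ)]
      calc ∑' n, ∑' y : c k n, ediam (closedBall (y : X) (r k n) ×ˢ t k n) ^ ((d + s : ℝ≥0) : ℝ)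
          ≤ ∑' n, ∑' _y : c k n, (2 * (r k n : ℝ≥0∞)) ^ ((d + s : ℝ≥0) : ℝ) := by
            refine ENNReal.tsum_le_tsum fun n ↦ ENNReal.tsum_le_tsum fun y ↦ ?_
            refine ENNReal.rpow_le_rpow ((ediam_prod_le _ _).trans (max_le ?_ ?_)) (d + s).coe_nonneg
            · exact ediam_closedBall_coe_le _ _
            · exact (hr k n).2.2.trans (le_mul_of_one_le_left zero_le one_le_two)
        _ = ∑' n, 2 ^ ((d + s : ℝ≥0) : ℝ) *
              (((c k n).card * (r k n : ℝ≥0∞) ^ (d : ℝ)) * (r k n : ℝ≥0∞) ^ (s : ℝ)) := by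
            refine tsum_congr fun n ↦ ?_
            rw [tsum_fintype, Finset.sum_const, nsmul_eq_mul,
              ENNReal.mul_rpow_of_nonneg _ _ (d + s).coe_nonneg, NNReal.coe_add,
              ENNReal.rpow_add_of_nonneg (x := (r k n : ℝ≥0∞)) _ _ d.coe_nonneg s.coe_nonneg]
            simp only [Finset.card_univ, Fintype.card_coe]
            ring
        _ ≤ ∑' n, 2 ^ ((d + s : ℝ≥0) : ℝ) * (M * (r k n : ℝ≥0∞) ^ (s : ℝ)) := by
            gcongr with n
            exact hcard k n
        _ = 2 ^ ((d + s : ℝ≥0) : ℝ) * (M * ∑' n, (r k n : ℝ≥0∞) ^ (s : ℝ)) := by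
            rw [ENNReal.tsum_mul_left, ENNReal.tsum_mul_left]
        _ ≤ 2 ^ ((d + s : ℝ≥0) : ℝ) * (M * 1) := by gcongr; exact hsum k
        _ = _ := by rw [mul_one]
  rw [← ENNReal.coe_add]
  refine dimH_le_of_hausdorffMeasure_ne_top (ne_top_of_le_ne_top ?_ hbound)
  exact ENNReal.mul_ne_top (ENNReal.rpow_ne_top_of_nonneg (d + s).coe_nonneg (by simp)) ENNReal.coe_ne_top

lemma HasPowerGrowth.dimH_prod_le {X Y : Type*} [MetricSpace X] [MeasurableSpace X]
    [BorelSpace X] [MetricSpace Y] {μ : Measure X} {d C ρ : ℝ≥0} (h : HasPowerGrowth μ d C ρ)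
    (A : Set X) (B : Set Y) : dimH (A ×ˢ B) ≤ d + dimH B := by
  rcases isEmpty_or_nonempty X with _ | ⟨⟨x⟩⟩
  · simp [eq_empty_of_isEmpty]
  have hsub : A ×ˢ B ⊆ ⋃ n : ℕ, closedBall x (n : ℝ) ×ˢ B := by
    rw [← iUnion_prod_const, iUnion_closedBall_nat]
    exact prod_mono_left (subset_univ A)
  refine (dimH_mono hsub).trans ?_
  rw [dimH_iUnion]
  refine iSup_le fun n ↦ ?_
  rcases eq_or_ne (dimH B) ⊤ with htop | hfin
  · simp [htop]
  lift dimH B to ℝ≥0 using hfin with b hb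
  rw [← ENNReal.coe_add]
  refine le_of_forall_gt_imp_ge_of_dense fun a ha ↦ ?_
  obtain ⟨a', h1, h2⟩ := ENNReal.lt_iff_exists_nnreal_btwn.1 ha
  have h1 : d + b < a' := by exact_mod_cast h1
  have hd : d ≤ a' := (le_add_of_nonneg_right b.2).trans h1.le
  have := h.dimH_closedBall_prod_le x n (B := B) (s := a' - d)
    (by rw [← hb]; exact_mod_cast lt_tsub_iff_left.2 h1)
  rw [← ENNReal.coe_add, add_tsub_cancel_of_le hd] at this
  exact this.trans h2.le

/-! ### Slicing -/

/-- Almost every vertical slice of a set of dimension less than `d + s` is `μH[s]`-null. -/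
lemma HasPowerGrowth.ae_hausdorffMeasure_slice_eq_zero {X Y : Type*} [MetricSpace X]
    [MeasurableSpace X] [BorelSpace X] [MetricSpace Y] [MeasurableSpace Y] [BorelSpace Y]
    {μ : Measure X} {d C ρ : ℝ≥0} (h : HasPowerGrowth μ d C ρ) {A : Set (X × Y)} {s : ℝ≥0}
    (hA : dimH A < d + s) : ∀ᵐ x ∂μ, μH[s] (Prod.mk x ⁻¹' A) = 0 := by
  have hA' : dimH A < ((s + d : ℝ≥0) : ℝ≥0∞) := by rwa [ENNReal.coe_add, add_comm]
  set w : ℕ → ℝ≥0∞ := fun k ↦ 2⁻¹ ^ k with hw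
  have hw0 : ∀ k, 0 < w k := fun k ↦ ENNReal.pow_pos (by simp) k
  have hwtop : ∀ k, w k ≠ ⊤ := fun k ↦ ENNReal.pow_ne_top (by simp)
  choose t htA htw htsum using fun k ↦ exists_cover_tsum_lt_of_dimH_lt hA' (hw0 k) (hw0 k)
  -- The projection of `t k n` may not be measurable; a ball about one of its points with radius the
  -- diameter replaces it.
  have hS : ∀ k n, ∃ S : Set X, MeasurableSet S ∧ Prod.fst '' t k n ⊆ S ∧
      ediam (t k n) ^ (s : ℝ) * μ S
        ≤ C * ⨆ _ : (t k n).Nonempty, ediam (t k n) ^ ((s + d : ℝ≥0) : ℝ) := by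
    intro k n
    rcases (t k n).eq_empty_or_nonempty with he | hne
    · exact ⟨∅, MeasurableSet.empty, by simp [he], by simp⟩
    obtain ⟨p, hp⟩ := hne
    have htop : ediam (t k n) ≠ ⊤ := ne_top_of_le_ne_top (hwtop k) (htw k n)
    refine ⟨closedBall p.1 (ediam (t k n)).toNNReal, measurableSet_closedBall, ?_, ?_⟩
    · rintro _ ⟨q, hq, rfl⟩
      rw [mem_closedBall, dist_nndist, NNReal.coe_le_coe, ← ENNReal.coe_le_coe,
        ENNReal.coe_toNNReal htop, ← edist_nndist]
      exact (le_max_left _ _).trans (edist_le_ediam_of_mem hq hp)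
    · calc ediam (t k n) ^ (s : ℝ) * μ (closedBall p.1 (ediam (t k n)).toNNReal)
          ≤ ediam (t k n) ^ (s : ℝ) * (C * ediam (t k n) ^ (d : ℝ)) := by
            gcongr
            simpa only [ENNReal.coe_toNNReal htop] using h.upper p.1 (ediam (t k n)).toNNReal
        _ = C * ediam (t k n) ^ ((s + d : ℝ≥0) : ℝ) := by
            rw [NNReal.coe_add, ENNReal.rpow_add_of_nonneg _ _ s.coe_nonneg d.coe_nonneg]
            ring
        _ ≤ _ := by
            gcongr
            exact le_iSup (fun _ : (t k n).Nonempty ↦ ediam (t k n) ^ ((s + d : ℝ≥0) : ℝ)) ⟨p, hp⟩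
  choose S hSmeas hSt hSμ using hS
  -- `f k x` dominates the `s`-dimensional sum of the cover that `t k` induces on the slice over
  -- `x`. Its integral is at most `C * 2⁻¹ ^ k`, so `f k → 0` almost everywhere.
  set f : ℕ → X → ℝ≥0∞ := fun k x ↦
    ∑' n, (S k n).indicator (fun _ ↦ ediam (t k n) ^ (s : ℝ)) x with hf
  have hfmeas : ∀ k, Measurable (f k) := fun k ↦
    Measurable.tsum fun n ↦ measurable_const.indicator (hSmeas k n)
  have hfint : ∀ k, ∫⁻ x, f k x ∂μ ≤ C * w k := fun k ↦ by
    rw [lintegral_tsum fun n ↦ (measurable_const.indicator (hSmeas k n)).aemeasurable]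
    calc ∑' n, ∫⁻ x, (S k n).indicator (fun _ ↦ ediam (t k n) ^ (s : ℝ)) x ∂μ
        = ∑' n, ediam (t k n) ^ (s : ℝ) * μ (S k n) :=
          tsum_congr fun n ↦ lintegral_indicator_const (hSmeas k n) _
      _ ≤ ∑' n, C * ⨆ _ : (t k n).Nonempty, ediam (t k n) ^ ((s + d : ℝ≥0) : ℝ) :=
          ENNReal.tsum_le_tsum (hSμ k)
      _ ≤ C * w k := by
          rw [ENNReal.tsum_mul_left]
          gcongr
          exact (htsum k).le
  have hfsum : ∫⁻ x, ∑' k, f k x ∂μ ≠ ⊤ := by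
    rw [lintegral_tsum fun k ↦ (hfmeas k).aemeasurable]
    refine ne_top_of_le_ne_top ?_ (ENNReal.tsum_le_tsum hfint)
    rw [ENNReal.tsum_mul_left, hw, ENNReal.tsum_geometric]
    exact ENNReal.mul_ne_top ENNReal.coe_ne_top (by simp)
  have hwlim : Tendsto w atTop (𝓝 0) :=
    ENNReal.tendsto_pow_atTop_nhds_zero_of_lt_one (by simp)
  filter_upwards [ae_lt_top (Measurable.tsum hfmeas) hfsum] with x hx
  have hlim : Tendsto (fun k ↦ f k x) atTop (𝓝 0) :=
    ENNReal.tendsto_atTop_zero_of_tsum_ne_top hx.ne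
  rw [← nonpos_iff_eq_zero, ← hlim.liminf_eq]
  -- Only nonempty slices are indexed: for `s = 0` an empty one would contribute `0 ^ 0 = 1`.
  refine (Measure.hausdorffMeasure_le_liminf_tsum
    (ι := fun k ↦ {n // (Prod.mk x ⁻¹' t k n).Nonempty}) (l := atTop) (s : ℝ) _ w hwlim
    (fun k i ↦ Prod.mk x ⁻¹' t k i) ?_ ?_).trans ?_
  · exact Eventually.of_forall fun k i ↦ (ediam_preimage_prodMk_le _ _).trans (htw k i)
  · refine Eventually.of_forall fun k y hy ↦ ?_
    obtain ⟨n, hn⟩ := mem_iUnion.1 (htA k hy)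
    exact mem_iUnion.2 ⟨⟨n, y, hn⟩, hn⟩
  · refine liminf_le_liminf (Eventually.of_forall fun k ↦ ?_)
    calc ∑' i : {n // (Prod.mk x ⁻¹' t k n).Nonempty}, ediam (Prod.mk x ⁻¹' t k i) ^ (s : ℝ)
        ≤ ∑' i : {n // (Prod.mk x ⁻¹' t k n).Nonempty},
            (S k i).indicator (fun _ ↦ ediam (t k i) ^ (s : ℝ)) x := by
          refine ENNReal.tsum_le_tsum fun ⟨n, y, hy⟩ ↦ ?_
          rw [indicator_of_mem (hSt k n ⟨(x, y), hy, rfl⟩)]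
          exact ENNReal.rpow_le_rpow (ediam_preimage_prodMk_le _ _) s.coe_nonneg
      _ ≤ f k x := ENNReal.tsum_comp_le_tsum_of_injective Subtype.val_injective _

lemma HasPowerGrowth.ae_slice_eq_empty {X Y : Type*} [MetricSpace X]
    [MeasurableSpace X] [BorelSpace X] [MetricSpace Y]
    {μ : Measure X} {d C ρ : ℝ≥0} (h : HasPowerGrowth μ d C ρ) {A : Set (X × Y)}
    (hA : dimH A < d) : ∀ᵐ x ∂μ, Prod.mk x ⁻¹' A = ∅ := by
  borelize Y
  filter_upwards [h.ae_hausdorffMeasure_slice_eq_zero (s := 0) (by simpa using hA)] with x hx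
  by_contra hne
  have := Measure.one_le_hausdorffMeasure_zero_of_nonempty (nonempty_iff_ne_empty.2 hne)
  rw [NNReal.coe_zero] at hx
  simp [hx] at this

lemma HasPowerGrowth.ae_dimH_slice_le {X Y : Type*} [MetricSpace X]
    [MeasurableSpace X] [BorelSpace X] [MetricSpace Y]
    {μ : Measure X} {d C ρ : ℝ≥0} (h : HasPowerGrowth μ d C ρ) {A : Set (X × Y)} {s : ℝ≥0}
    (hA : dimH A ≤ d + s) : ∀ᵐ x ∂μ, dimH (Prod.mk x ⁻¹' A) ≤ s := by
  borelize Y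
  obtain ⟨u, -, hu, hulim⟩ := exists_seq_strictAnti_tendsto s
  have hlt : ∀ n, dimH A < d + u n := fun n ↦ hA.trans_lt <|
    ENNReal.add_lt_add_left ENNReal.coe_ne_top (ENNReal.coe_lt_coe.2 (hu n))
  filter_upwards [ae_all_iff.2 fun n ↦ h.ae_hausdorffMeasure_slice_eq_zero (hlt n)] with x hx
  refine ge_of_tendsto' (ENNReal.tendsto_coe.2 hulim) fun n ↦ ?_
  exact dimH_le_of_hausdorffMeasure_ne_top (by simp [hx n])

/-- For the lower bound, the copy `X × {x₀}` has no empty slice, so its dimension cannot be below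
`d`. -/
lemma HasPowerGrowth.dimH_univ {X : Type*} [MetricSpace X] [MeasurableSpace X] [BorelSpace X]
    [Nonempty X] {μ : Measure X} {d C ρ : ℝ≥0} (h : HasPowerGrowth μ d C ρ) :
    dimH (univ : Set X) = d := by
  let x₀ : X := Classical.arbitrary X
  refine le_antisymm ?_ (le_of_not_gt fun hlt ↦ ?_)
  · calc dimH (univ : Set X) = dimH (Prod.fst '' ((univ : Set X) ×ˢ {x₀})) := by
          rw [fst_image_prod _ (singleton_nonempty x₀)]
      _ ≤ dimH ((univ : Set X) ×ˢ {x₀}) := LipschitzWith.prod_fst.dimH_image_le _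
      _ ≤ d + dimH {x₀} := h.dimH_prod_le _ _
      _ = d := by rw [dimH_singleton, add_zero]
  · have hA : dimH (range fun x : X ↦ (x, x₀)) < d :=
      ((LipschitzWith.prodMk_right x₀).dimH_range_le).trans_lt hlt
    have : NeBot (ae μ) := ae_neBot.2 h.measure_ne_zero
    obtain ⟨x, hx⟩ := (h.ae_slice_eq_empty hA).exists
    exact (hx.le ⟨x, rfl⟩ : x₀ ∈ (∅ : Set X))

/-! ### The convention for the empty set -/

lemma hausdorffDim_empty {X : Type*} [MetricSpace X] : hausdorffDim (∅ : Set X) = -1 := by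
  simp [hausdorffDim]

lemma hausdorffDim_of_nonempty {X : Type*} [MetricSpace X] {A : Set X} (hA : A.Nonempty) :
    hausdorffDim A = dimH A := by
  simp [hausdorffDim, hA.ne_empty]

lemma EReal.neg_one_eq_coe : (-1 : EReal) = ((-1 : ℝ) : EReal) := rfl

lemma EReal.coe_sub_one_eq (a : ℝ) : (a : EReal) - 1 = ((a - 1 : ℝ) : EReal) := rfl

lemma hausdorffDim_mono {X : Type*} [MetricSpace X] {A B : Set X} (h : A ⊆ B) :
    hausdorffDim A ≤ hausdorffDim B := by
  rcases B.eq_empty_or_nonempty with rfl | hB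
  · rw [subset_empty_iff.1 h]
  rw [hausdorffDim_of_nonempty hB]
  rcases A.eq_empty_or_nonempty with rfl | hA
  · rw [hausdorffDim_empty]
    exact (EReal.neg_le_zero.2 zero_le_one).trans (EReal.coe_ennreal_nonneg _)
  · rw [hausdorffDim_of_nonempty hA]
    exact EReal.coe_ennreal_le_coe_ennreal_iff.2 (dimH_mono h)

lemma EReal.coe_nnreal_eq_coe_ennreal (a : ℝ≥0) : ((a : ℝ) : EReal) = ((a : ℝ≥0∞) : EReal) := rfl

lemma HasPowerGrowth.ae_hausdorffDim_slice_le_neg_one {X Y : Type*} [MetricSpace X]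
    [MeasurableSpace X] [BorelSpace X] [MetricSpace Y]
    {μ : Measure X} {d C ρ : ℝ≥0} (h : HasPowerGrowth μ d C ρ) {A : Set (X × Y)}
    (hA : hausdorffDim A < ((d : ℝ) : EReal)) : ∀ᵐ x ∂μ, hausdorffDim (Prod.mk x ⁻¹' A) ≤ -1 := by
  rcases A.eq_empty_or_nonempty with rfl | hne
  · simp [hausdorffDim_empty]
  rw [hausdorffDim_of_nonempty hne, EReal.coe_nnreal_eq_coe_ennreal,
    EReal.coe_ennreal_lt_coe_ennreal_iff] at hA
  filter_upwards [h.ae_slice_eq_empty hA] with x hx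
  rw [hx, hausdorffDim_empty]

lemma HasPowerGrowth.ae_hausdorffDim_slice_le {X Y : Type*} [MetricSpace X]
    [MeasurableSpace X] [BorelSpace X] [MetricSpace Y]
    {μ : Measure X} {d C ρ : ℝ≥0} (h : HasPowerGrowth μ d C ρ) {A : Set (X × Y)} {s : ℝ≥0}
    (hA : hausdorffDim A ≤ (((d + s : ℝ≥0) : ℝ) : EReal)) :
    ∀ᵐ x ∂μ, hausdorffDim (Prod.mk x ⁻¹' A) ≤ ((s : ℝ) : EReal) := by
  rcases A.eq_empty_or_nonempty with rfl | hne
  · refine Eventually.of_forall fun x ↦ ?_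
    rw [preimage_empty, hausdorffDim_empty]
    exact (EReal.neg_le_zero.2 zero_le_one).trans (EReal.coe_nonneg.2 s.coe_nonneg)
  rw [hausdorffDim_of_nonempty hne, EReal.coe_nnreal_eq_coe_ennreal,
    EReal.coe_ennreal_le_coe_ennreal_iff, ENNReal.coe_add] at hA
  filter_upwards [h.ae_dimH_slice_le hA] with x hx
  rcases (Prod.mk x ⁻¹' A).eq_empty_or_nonempty with he | hne'
  · rw [he, hausdorffDim_empty]
    exact (EReal.neg_le_zero.2 zero_le_one).trans (EReal.coe_nonneg.2 s.coe_nonneg)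
  · rw [hausdorffDim_of_nonempty hne', EReal.coe_nnreal_eq_coe_ennreal]
    exact EReal.coe_ennreal_le_coe_ennreal_iff.2 hx

lemma topHausdorffDim_eq_sInf (X : Type*) [MetricSpace X] [Nonempty X] :
    topHausdorffDim X = sInf {c : EReal | ∃ B : Set (Set X), IsTopologicalBasis B ∧
      ∀ U ∈ B, hausdorffDim (frontier U) ≤ c - 1} := by
  simp [topHausdorffDim]

lemma topHausdorffDim_le {X : Type*} [MetricSpace X] [Nonempty X] {B : Set (Set X)} {c : EReal}
    (hB : IsTopologicalBasis B) (h : ∀ U ∈ B, hausdorffDim (frontier U) ≤ c - 1) :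
    topHausdorffDim X ≤ c := by
  rw [topHausdorffDim_eq_sInf]
  exact sInf_le ⟨B, hB, h⟩

lemma nonempty_of_one_le_topHausdorffDim {Y : Type*} [MetricSpace Y]
    (hY : 1 ≤ topHausdorffDim Y) : Nonempty Y := by
  by_contra hne
  rw [not_nonempty_iff] at hne
  simp only [topHausdorffDim, hne, if_true] at hY
  exact absurd hY (by rw [EReal.neg_one_eq_coe]; norm_cast)

/-! ### The two inequalities -/

lemma HasPowerGrowth.topHausdorffDim_prod_le {X Y : Type*} [MetricSpace X] [MeasurableSpace X]
    [BorelSpace X] [MetricSpace Y] [Nonempty X] [LocallyCompactSpace X]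
    [TotallyDisconnectedSpace X] {μ : Measure X} {d C ρ : ℝ≥0} (h : HasPowerGrowth μ d C ρ)
    (hY : 1 ≤ topHausdorffDim Y) :
    topHausdorffDim (X × Y) ≤ ((d : ℝ) : EReal) + topHausdorffDim Y := by
  have := nonempty_of_one_le_topHausdorffDim hY
  -- Moving the finite `d` to the left leaves an infimum over bases of `Y` alone on the right.
  rw [add_comm, ← EReal.sub_le_iff_le_add (.inl (EReal.coe_ne_bot _)) (.inl (EReal.coe_ne_top _))]
  rw [topHausdorffDim_eq_sInf Y] at hY ⊢
  refine le_sInf fun c hc ↦ ?_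
  have hc1 : 1 ≤ c := hY.trans (sInf_le hc)
  rw [EReal.sub_le_iff_le_add (.inl (EReal.coe_ne_bot _)) (.inl (EReal.coe_ne_top _))]
  induction c with
  | bot => exact absurd hc1 (not_le.2 (EReal.bot_lt_coe 1))
  | top => simp
  | coe c =>
  obtain ⟨B, hB, hBc⟩ := hc
  have hc1 : 1 ≤ c := by exact_mod_cast hc1
  refine topHausdorffDim_le ((loc_compact_Haus_tot_disc_of_zero_dim (H := X)).prod hB) ?_
  rintro _ ⟨V, hV, U, hU, rfl⟩
  have hVcl : IsClopen V := hV
  rw [frontier_prod_eq, hVcl.frontier_eq, empty_prod, union_empty]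
  rcases (closure V ×ˢ frontier U).eq_empty_or_nonempty with he | hne
  · rw [he, hausdorffDim_empty, EReal.neg_one_eq_coe, ← EReal.coe_add, EReal.coe_sub_one_eq,
      EReal.coe_le_coe_iff]
    linarith [d.coe_nonneg]
  · rw [hausdorffDim_of_nonempty hne]
    have hU' := hBc U hU
    rw [hausdorffDim_of_nonempty hne.snd] at hU'
    calc ((dimH (closure V ×ˢ frontier U) : ℝ≥0∞) : EReal)
        ≤ ((d + dimH (frontier U) : ℝ≥0∞) : EReal) :=
          EReal.coe_ennreal_le_coe_ennreal_iff.2 (h.dimH_prod_le _ _)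
      _ = ((d : ℝ) : EReal) + dimH (frontier U) := by rw [EReal.coe_ennreal_add]; rfl
      _ ≤ ((d : ℝ) : EReal) + (c - 1) := by gcongr
      _ = c + ((d : ℝ) : EReal) - 1 := by norm_cast; ring_nf

lemma HasPowerGrowth.le_topHausdorffDim_prod {X Y : Type*} [MetricSpace X] [MeasurableSpace X]
    [BorelSpace X] [MetricSpace Y] [Nonempty X] [SeparableSpace Y]
    {μ : Measure X} {d C ρ : ℝ≥0} (h : HasPowerGrowth μ d C ρ)
    (hY : 1 ≤ topHausdorffDim Y) :
    ((d : ℝ) : EReal) + topHausdorffDim Y ≤ topHausdorffDim (X × Y) := by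
  have := nonempty_of_one_le_topHausdorffDim hY
  have := h.secondCountableTopology
  have : SecondCountableTopology Y := UniformSpace.secondCountable_of_separable Y
  have : NeBot (ae μ) := ae_neBot.2 h.measure_ne_zero
  rw [topHausdorffDim_eq_sInf (X × Y)]
  refine le_sInf fun c ⟨B', hB', hB'c⟩ ↦ ?_
  obtain ⟨B, hBB', hBcount, hB⟩ := hB'.exists_countable
  have hBc : ∀ U ∈ B, hausdorffDim (frontier U) ≤ c - 1 := fun U hU ↦ hB'c U (hBB' hU)
  have hslice : ∀ e : EReal, (∀ U ∈ B, ∀ᵐ x ∂μ, hausdorffDim (Prod.mk x ⁻¹' frontier U) ≤ e - 1) →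
      topHausdorffDim Y ≤ e := by
    intro e hae
    obtain ⟨x, hx⟩ := ((ae_ball_iff hBcount).2 hae).exists
    refine topHausdorffDim_le (hB.isInducing (isInducing_prodMkRight x)) ?_
    rintro _ ⟨U, hU, rfl⟩
    exact (hausdorffDim_mono ((Continuous.prodMk_right x).frontier_preimage_subset U)).trans
      (hx U hU)
  -- Below `d + 1` almost every boundary slice is empty, of dimension `-1`; from there on, `s = c -
  -- d - 1` is nonnegative and bounds the slice dimensions.
  rcases lt_or_ge c (((d : ℝ) : EReal) + 1) with hlt | hge
  · have h0 : topHausdorffDim Y ≤ 0 := hslice 0 fun U hU ↦ by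
      rw [zero_sub]
      exact h.ae_hausdorffDim_slice_le_neg_one
        ((hBc U hU).trans_lt (EReal.sub_lt_of_lt_add hlt))
    exact absurd (hY.trans h0) (not_le.2 zero_lt_one)
  induction c with
  | bot => exact absurd hge (not_le.2 (EReal.bot_lt_coe ((d : ℝ) + 1)))
  | top => exact le_top
  | coe c =>
  have hge : (d : ℝ) + 1 ≤ c := by exact_mod_cast hge
  obtain ⟨s, hs⟩ : ∃ s : ℝ≥0, c = d + s + 1 := by
    refine ⟨(c - d - 1).toNNReal, ?_⟩
    rw [Real.coe_toNNReal _ (by linarith)]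
    ring
  have hY' : topHausdorffDim Y ≤ (((s : ℝ) + 1 : ℝ) : EReal) := hslice _ fun U hU ↦ by
    have h1 : ((c : ℝ) : EReal) - 1 = (((d + s : ℝ≥0) : ℝ) : EReal) := by
      rw [hs, EReal.coe_sub_one_eq, NNReal.coe_add, add_sub_cancel_right]
    have h2 : (((s : ℝ) + 1 : ℝ) : EReal) - 1 = ((s : ℝ) : EReal) := by
      rw [EReal.coe_sub_one_eq, add_sub_cancel_right]
    rw [h2]
    exact h.ae_hausdorffDim_slice_le ((hBc U hU).trans h1.le)
  calc ((d : ℝ) : EReal) + topHausdorffDim Y ≤ ((d : ℝ) : EReal) + (((s : ℝ) + 1 : ℝ) : EReal) := by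
        gcongr
    _ = c := by
        rw [hs, ← EReal.coe_add, add_assoc]

theorem theorem5p6 {X Y : Type*} [MetricSpace X] [MeasurableSpace X] [BorelSpace X]
    [MetricSpace Y] [Nonempty X] [LocallyCompactSpace X] [TotallyDisconnectedSpace X]
    [TopologicalSpace.SeparableSpace Y]
    (d : ℝ) (hX : IsAhlforsRegular X d) (hY : 1 ≤ topHausdorffDim Y) :
    topHausdorffDim (X × Y) = hausdorffDim (Set.univ : Set X) + topHausdorffDim Y := by
  obtain ⟨μ, d', C, ρ, h⟩ := hX.exists_hasPowerGrowth
  rw [hausdorffDim_of_nonempty univ_nonempty, h.dimH_univ, ← EReal.coe_nnreal_eq_coe_ennreal]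
  exact le_antisymm (h.topHausdorffDim_prod_le hY) (h.le_topHausdorffDim_prod hY)
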